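/- **Notation.** For a finite-valued convex function $J:\mathbb R^N\to\mathbb R$ and $z\in\mathbb R^N$, let $\partial J(z)$ be the subdifferential of $J$ at $z$, let $\bar S_z$ be the affine hull of $\partial J(z)$, $S_z$ the linear subspace parallel to $\bar S_z$, $T_z=S_z^{\perp}$, and $e_z$ the orthogonal projection of $0$ onto $\bar S_z$. The gauge of a set $C\ni 0$ is $\gamma_C(u)=\inf\{t>0: u\in tC\}\in[0,+\infty]$, with $\inf\emptyset=+\infty$; a *gauge* is the gauge $\gamma_C$ of a closed convex set $C$ containing $0$. For $v\in\operatorname{ri}\partial J(z)$ (relative interior) let $J^{z,\circ}_{v}=\gamma_{\partial J(z)-v}$ be the subdifferential gauge. $P_S$ is the orthogonal projection onto a subspace $S$. $J$ is *partly smooth at $x$ relative to* $M\subseteq\mathbb R^N$ if (i) $x\in M$, $M$ is a $C^2$-manifold around $x$, and the restriction of $J$ to $M$ is $C^2$ around $x$; (ii) the tangent space of $M$ at $x$ is $T_x$; (iii) the set-valued map $\partial J$ is continuous (inner and outer semicontinuous) at $x$ relative to $M$. The set-valued map $\partial J$ is *Lipschitz-continuous around $x$ relative to $M$* if there are $\beta\ge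 0$ and a neighbourhood $U$ of $x$ with $\partial J(y)\subseteq\partial J(z)+\beta\|y-z\|\,\mathbb B$ for all $y,z\in U\cap M$, where $\mathbb B$ is the closed unit ball. A *Lipschitz selection around $x$* is a map $f$, $y\mapsto f_y$, such that for some neighbourhood $U$ of $x$, $f$ is Lipschitz-continuous on $U\cap T_x$ and $f_{y}\in\operatorname{ri}\partial J(y)$ for all $y\in U\cap T_x$. **Theorem 4.1.** Let $J:\mathbb R^N\to\mathbb R$ be convex and partly smooth at $x\in\mathbb R^N$ relative to $T=T_x$, and assume that $\partial J$ is Lipschitz-continuous around $x$ relative to $T$. Let $\Gamma$ be any gauge which is finite and coercive on $T$. Write $S=S_x$. Then a Lipschitz selection around $x$ exists, and for every Lipschitz selection $f$ around $x$ there exist real numbers $\nu>0$ and $\mu,\tau,\xi\ge 0$ such that $$\forall x'\in T,\qquad \Gamma(x-x')\le\nu\ \Longrightarrow\ T_{x'}=T_x,$$ and, for every $x'\in T$ with $\Gamma(x-x')<\nu$, $$\Gamma(e_x-e_{x'})\le\mu\,\Gamma(x-x'),$$ $$J^{x,\circ}_{f_x}\bigl(P_S(f_x-f_{x'})\bigr)\le\tau\,\Gamma(x-x'),$$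 $$\sup_{u\in S,\ u\ne 0}\frac{J^{x',\circ}_{f_{x'}}(u)-J^{x,\circ}_{f_x}(u)}{J^{x,\circ}_{f_x}(u)}\le\xi\,\Gamma(x-x'),$$ where the supremum over the empty set (the case $S=\{0\}$) is $-\infty$. -/

import Mathlib

open Set Filter
open scoped Topology Pointwise

noncomputable section

variable {E : Type*} [NormedAddCommGroup E] [InnerProductSpace ℝ E]

/-- The subdifferential of a finite-valued function `J` at `x`. -/
def subdiff (J : E → ℝ) (x : E) : Set E :=
  {u : E | ∀ y : E, J x + inner ℝ u (y - x) ≤ J y}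

/-- The affine hull of the subdifferential of `J` at `x`. -/
def subdiffAff (J : E → ℝ) (x : E) : AffineSubspace ℝ E :=
  affineSpan ℝ (subdiff J x)

/-- `S_x`, the linear subspace parallel to the affine hull of the subdifferential. -/
def paraSubspace (J : E → ℝ) (x : E) : Submodule ℝ E :=
  (subdiffAff J x).direction

/-- The model subspace `T_x`, the orthogonal complement of `S_x`. -/
def modelSubspace (J : E → ℝ) (x : E) : Submodule ℝ E :=
  (paraSubspace J x)ᗮ

open Classical in
/-- `e_x`, the orthogonal projection of `0` onto the affine hull of the subdifferential. That hull
is non-empty whenever `J` is convex and finite-valued on a finite-dimensional space; the value `0`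
in the remaining case is a convention without any role. -/
def modelVector [FiniteDimensional ℝ E] (J : E → ℝ) (x : E) : E :=
  if h : (subdiffAff J x : Set E).Nonempty then
    haveI : Nonempty (subdiffAff J x) := h.to_subtype
    (EuclideanGeometry.orthogonalProjection (subdiffAff J x) 0 : E)
  else 0

/-- The gauge `u ↦ inf {t > 0 | u ∈ t C}` of a set `C`, with value `+∞` when there is no such `t`. -/
def gaugeFun (C : Set E) (u : E) : EReal :=
  ⨅ t ∈ {t : ℝ | 0 < t ∧ u ∈ t • C}, (t : EReal)

/-- A function is a gauge if it is the gauge of a closed convex set containing the origin. -/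
def IsGauge (Γ : E → EReal) : Prop :=
  ∃ C : Set E, IsClosed C ∧ Convex ℝ C ∧ (0 : E) ∈ C ∧ Γ = gaugeFun C

/-- `Γ` is finite and coercive on the subspace `T`. -/
def FiniteCoerciveOn (Γ : E → EReal) (T : Submodule ℝ E) : Prop :=
  (∀ u ∈ T, Γ u < ⊤) ∧ Tendsto Γ (comap norm atTop ⊓ 𝓟 (T : Set E)) (𝓝 ⊤)

/-- The subdifferential gauge associated to `v`: the gauge of `∂J(x) - v`. -/
def subdiffGauge (J : E → ℝ) (x v : E) : E → EReal :=
  gaugeFun ((fun η => η - v) '' subdiff J x)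

/-- The set `M` is a `C²` manifold around its point `x`: near `x` it is the zero set of a `C²` map
with surjective derivative. -/
def IsC2ManifoldAround (M : Set E) (x : E) : Prop :=
  x ∈ M ∧ ∃ (k : ℕ) (Φ : E → EuclideanSpace ℝ (Fin k)), ContDiffAt ℝ 2 Φ x ∧
    Function.Surjective (fderiv ℝ Φ x) ∧ ∀ᶠ y in 𝓝 x, y ∈ M ↔ Φ y = 0

/-- The restriction of `J` to `M` is `C²` around `x`: near `x` in `M` it agrees with a function
that is `C²` around `x`. -/
def IsC2RestrictAround (J : E → ℝ) (M : Set E) (x : E) : Prop :=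
  ∃ g : E → ℝ, ContDiffAt ℝ 2 g x ∧ ∀ᶠ y in 𝓝[M] x, J y = g y

/-- The inner limit (Painlevé–Kuratowski) of `F y` as `y → x` in `M`. -/
def innerLimit (F : E → Set E) (M : Set E) (x : E) : Set E :=
  {v : E | ∀ ε > 0, ∀ᶠ y in 𝓝[M] x, ∃ w ∈ F y, ‖w - v‖ < ε}

/-- The outer limit (Painlevé–Kuratowski) of `F y` as `y → x` in `M`. -/
def outerLimit (F : E → Set E) (M : Set E) (x : E) : Set E :=
  {v : E | ∀ ε > 0, ∃ᶠ y in 𝓝[M] x, ∃ w ∈ F y, ‖w - v‖ < ε}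

/-- The set-valued map `F` is continuous at `x` relative to `M`. -/
def SetContinuousAt (F : E → Set E) (M : Set E) (x : E) : Prop :=
  F x ⊆ innerLimit F M x ∧ outerLimit F M x ⊆ F x

/-- The set-valued map `F` is Lipschitz-continuous around `x` relative to `M`. -/
def SetLipschitzAround (F : E → Set E) (M : Set E) (x : E) : Prop :=
  ∃ β : ℝ, 0 ≤ β ∧ ∃ U ∈ 𝓝 x, ∀ y ∈ U ∩ M, ∀ z ∈ U ∩ M,
    F y ⊆ F z + Metric.closedBall (0 : E) (β * ‖y - z‖)

/-- A function `J` is partly smooth at `x` relative to the set `M` (to be used for convex `J`). The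
tangent space of `M` at `x` is the tangent cone of `M` at `x`, which is a linear subspace for a
`C²` manifold. -/
structure PartlySmoothAt (J : E → ℝ) (x : E) (M : Set E) : Prop where
  manifold : IsC2ManifoldAround M x
  smooth : IsC2RestrictAround J M x
  sharp : tangentConeAt ℝ M x = (modelSubspace J x : Set E)
  continuous : SetContinuousAt (subdiff J) M x

/-- On the points of the model subspace `T_x` near `x`, the map `f` is a Lipschitz-continuous
selection of the relative interiors of the subdifferentials of `J`. -/
def IsLipschitzSelectionAround (J : E → ℝ) (x : E) (f : E → E) : Prop :=
  ∃ U ∈ 𝓝 x, (∃ β : NNReal, LipschitzOnWith β f (U ∩ (modelSubspace J x : Set E))) ∧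
    ∀ y ∈ U ∩ (modelSubspace J x : Set E), f y ∈ intrinsicInterior ℝ (subdiff J y)

end

/-! Along `T` near `x`, `J` agrees with a `C²` function `g`, so all subgradients at a nearby `y ∈ T`
have the same inner products with `T`; hence `S_y ⊆ S_x`. Conversely, `∂J(x)` contains a relative
ball and is `O(‖x - y‖)`-close to `∂J(y)`, so no direction of `S_x` is lost
(`paraSubspace_le_of_close`) and `T_y = T_x`.

Then `e_x - e_y` is the `T`-component of any difference of subgradients at `x` and `y`, so it
inherits the Lipschitz bound `β ‖x - y‖`. The other two points rest on cancellation of a compact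
summand (`mem_of_forall_add_mem_add`): if `a + D ⊆ K + D` with `K` closed convex, then `a ∈ K`. It
shows that relative balls persist nearby, so that `v + (e_y - e_x)` is a Lipschitz selection, and
that `(1 - δ) • (∂J(x) - f_x) ⊆ ∂J(y) - f_y` with `δ` proportional to `‖x - y‖`. Gauges then grow by
a factor at most `1 / (1 - δ) ≤ 1 + 2δ`.

All estimates are made in norm; they transfer to `Γ` because a finite coercive gauge is equivalent
to the norm on `T`. -/

/-! ### Gauges and their comparison with the norm on a subspace -/

section Gauge

variable {E : Type*} [NormedAddCommGroup E] [InnerProductSpace ℝ E]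

theorem gaugeFun_le {C : Set E} {u : E} {t : ℝ} (ht : 0 < t) (hu : u ∈ t • C) :
    gaugeFun C u ≤ t :=
  iInf₂_le (f := fun (t : ℝ) (_ : t ∈ {t : ℝ | 0 < t ∧ u ∈ t • C}) => (t : EReal)) t ⟨ht, hu⟩

theorem le_gaugeFun {C : Set E} {u : E} {a : EReal}
    (h : ∀ t : ℝ, 0 < t → u ∈ t • C → a ≤ t) : a ≤ gaugeFun C u :=
  le_iInf₂ fun t ht => h t ht.1 ht.2

theorem exists_of_gaugeFun_lt {C : Set E} {u : E} {a : EReal} (h : gaugeFun C u < a) :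
    ∃ t : ℝ, 0 < t ∧ u ∈ t • C ∧ (t : EReal) < a := by
  by_contra! H
  exact absurd (le_gaugeFun H) (not_le.2 h)

theorem gaugeFun_nonneg (C : Set E) (u : E) : 0 ≤ gaugeFun C u :=
  le_gaugeFun fun t ht _ => by exact_mod_cast ht.le

theorem exists_real_eq_gaugeFun {C : Set E} {u : E} (h : gaugeFun C u < ⊤) :
    ∃ g : ℝ, 0 ≤ g ∧ gaugeFun C u = g := by
  have h0 := gaugeFun_nonneg C u
  refine ⟨(gaugeFun C u).toReal, EReal.toReal_nonneg h0, ?_⟩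
  rw [EReal.coe_toReal h.ne]
  exact ne_of_gt (lt_of_lt_of_le EReal.bot_lt_zero h0)

/-- The gauge of a set containing the ball of radius `r` of a subspace is at most `‖u‖ / r` there. -/
theorem gaugeFun_le_norm_div {C : Set E} {S : Submodule ℝ E} {r : ℝ} (hr : 0 < r)
    (hC : ∀ w ∈ S, ‖w‖ ≤ r → w ∈ C) {u : E} (hu : u ∈ S) :
    gaugeFun C u ≤ ((‖u‖ / r : ℝ) : EReal) := by
  -- Comparing with every real `q` above the bound avoids dividing by zero when `u = 0`.
  refine EReal.le_of_forall_lt_iff_le.1 fun q hq => ?_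
  have hq' : ‖u‖ / r < q := by exact_mod_cast hq
  have hq0 : 0 < q := lt_of_le_of_lt (by positivity) hq'
  refine gaugeFun_le hq0 ((mem_smul_set_iff_inv_smul_mem₀ hq0.ne' _ _).2 ?_)
  refine hC _ (S.smul_mem _ hu) ?_
  rw [norm_smul, norm_inv, Real.norm_of_nonneg hq0.le, inv_mul_le_iff₀ hq0]
  exact ((div_lt_iff₀ hr).1 hq').le

/-- The gauge of a set whose trace on a subspace is bounded by `R` is at least `‖u‖ / R` there. -/
theorem norm_div_le_gaugeFun {C : Set E} {S : Submodule ℝ E} {R : ℝ} (hR : 0 < R)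
    (hC : ∀ c ∈ C, c ∈ S → ‖c‖ ≤ R) {u : E} (hu : u ∈ S) :
    ((‖u‖ / R : ℝ) : EReal) ≤ gaugeFun C u := by
  refine le_gaugeFun fun t ht hut => ?_
  have h1 := (mem_smul_set_iff_inv_smul_mem₀ ht.ne' _ _).1 hut
  have h2 := hC _ h1 (S.smul_mem _ hu)
  rw [norm_smul, norm_inv, Real.norm_of_nonneg ht.le, inv_mul_le_iff₀ ht] at h2
  exact_mod_cast (div_le_iff₀ hR).2 h2

theorem gaugeFun_le_div_of_smul_mem {C C' : Set E} {s g : ℝ} (hs : 0 < s)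
    (h : ∀ c ∈ C, s • c ∈ C') {u : E} (hg : gaugeFun C u = g) :
    gaugeFun C' u ≤ ((g / s : ℝ) : EReal) := by
  refine EReal.le_of_forall_lt_iff_le.1 fun q hq => ?_
  have hq' : g / s < q := by exact_mod_cast hq
  have h1 : gaugeFun C u < ((q * s : ℝ) : EReal) := by
    rw [hg]; exact_mod_cast (div_lt_iff₀ hs).1 hq'
  obtain ⟨t, ht, ⟨c, hc, rfl⟩, htq⟩ := exists_of_gaugeFun_lt h1
  have htq' : t < q * s := by exact_mod_cast htq
  refine (gaugeFun_le (t := t / s) (by positivity) ⟨s • c, h c hc, ?_⟩).trans ?_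
  · simp only [smul_smul]
    rw [div_mul_cancel₀ _ hs.ne']
  · exact_mod_cast ((div_lt_iff₀ hs).2 htq').le

/-- A closed convex set containing `0` whose gauge is finite on a subspace contains a ball of that
subspace. -/
theorem exists_ball_subset_of_gaugeFun_lt_top [FiniteDimensional ℝ E] {C : Set E}
    (hcl : IsClosed C) (hcv : Convex ℝ C) (h0 : (0 : E) ∈ C) {T : Submodule ℝ E}
    (hfin : ∀ u ∈ T, gaugeFun C u < ⊤) :
    ∃ r : ℝ, 0 < r ∧ ∀ w ∈ T, ‖w‖ ≤ r → w ∈ C := by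
  set D : Set T := (fun w : T => (w : E)) ⁻¹' C with hD
  have hDcl : IsClosed D := hcl.preimage continuous_subtype_val
  have hDcv : Convex ℝ D := hcv.linear_preimage T.subtype
  have hD0 : (0 : T) ∈ D := h0
  have habs : ∀ u : T, ∃ t : ℝ, 0 < t ∧ u ∈ t • D := by
    intro u
    obtain ⟨t, ht, hut, -⟩ := exists_of_gaugeFun_lt (hfin u u.2)
    refine ⟨t, ht, (mem_smul_set_iff_inv_smul_mem₀ ht.ne' _ _).2 ?_⟩
    have := (mem_smul_set_iff_inv_smul_mem₀ ht.ne' _ _).1 hut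
    exact this
  -- Baire: countably many closed dilates of `D` cover `T`, so one of them, hence `D`, has an
  -- interior point `a`.
  have hU : ⋃ n : ℕ, ((n : ℝ) + 1) • D = univ := by
    refine eq_univ_of_forall fun u => mem_iUnion.2 ?_
    obtain ⟨t, ht, hut⟩ := habs u
    obtain ⟨n, hn⟩ := exists_nat_ge t
    have hn1 : (0 : ℝ) < (n : ℝ) + 1 := by positivity
    refine ⟨n, (mem_smul_set_iff_inv_smul_mem₀ hn1.ne' _ _).2 ?_⟩
    obtain ⟨d, hd, rfl⟩ := hut
    have := hDcv.smul_mem_of_zero_mem hD0 hd (t := ((n : ℝ) + 1)⁻¹ * t)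
      ⟨by positivity, by rw [inv_mul_le_iff₀ hn1]; linarith⟩
    simpa [smul_smul] using this
  obtain ⟨n, hn⟩ := nonempty_interior_of_iUnion_of_closed
    (fun n : ℕ => hDcl.smul_of_ne_zero (c := (n : ℝ) + 1) (by positivity)) hU
  rw [interior_smul₀ (by positivity : ((n : ℝ) + 1) ≠ 0)] at hn
  obtain ⟨_, a, ha, -⟩ := hn
  obtain ⟨t, ht, d, hd, hda⟩ := habs (-a)
  -- Some `d ∈ D` is a positive multiple of `-a`, so `0` lies in the open segment from the interior
  -- point `a` to `d`.
  have h0i : (0 : T) ∈ interior D := by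
    refine hDcv.openSegment_interior_self_subset_interior ha hd
      ⟨1 / (1 + t), t / (1 + t), by positivity, by positivity, by field_simp, ?_⟩
    have hda' : t • d = -a := hda
    rw [div_eq_inv_mul, div_eq_inv_mul, mul_smul, mul_smul, hda']
    simp
  obtain ⟨r, hr, hball⟩ := Metric.mem_nhds_iff.1 (mem_interior_iff_mem_nhds.1 h0i)
  refine ⟨r / 2, by positivity, fun w hw hwr => ?_⟩
  have : (⟨w, hw⟩ : T) ∈ D := hball (by
    rw [mem_ball_zero_iff]
    change ‖w‖ < r
    linarith)
  exact this

/-- A gauge that is coercive on a subspace comes from a set with bounded trace there. -/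
theorem exists_norm_le_of_tendsto_gaugeFun {C : Set E} {T : Submodule ℝ E}
    (hco : Tendsto (gaugeFun C) (comap norm atTop ⊓ 𝓟 (T : Set E)) (𝓝 ⊤)) :
    ∃ R : ℝ, 0 < R ∧ ∀ c ∈ C, c ∈ T → ‖c‖ ≤ R := by
  -- Points of `C` have gauge at most `1`, which coercivity forbids far out in `T`.
  have h := hco.eventually (lt_mem_nhds (show (1 : EReal) < ⊤ from EReal.coe_lt_top 1))
  rw [eventually_inf_principal, eventually_comap] at h
  obtain ⟨R, hR⟩ := eventually_atTop.1 h
  refine ⟨max R 1, by positivity, fun c hc hcT => ?_⟩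
  by_contra! hlt
  have h1 := hR ‖c‖ ((le_max_left _ _).trans hlt.le) c rfl hcT
  have h2 : gaugeFun C c ≤ ((1 : ℝ) : EReal) := gaugeFun_le one_pos (by simpa using hc)
  exact absurd h1 (not_lt.2 h2)

end Gauge

/-! ### Cancellation of convex sets and relative interiors -/

section Convex

variable {E : Type*} [NormedAddCommGroup E] [InnerProductSpace ℝ E]

/-- Cancellation of a compact summand from an inclusion into a closed convex set. -/
theorem mem_of_forall_add_mem_add {K D : Set E} (hKc : IsClosed K) (hKv : Convex ℝ K)
    (hD : IsCompact D) (hDn : D.Nonempty) {a : E}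
    (h : ∀ d ∈ D, ∃ k ∈ K, ∃ d' ∈ D, a + d = k + d') : a ∈ K := by
  by_contra ha
  -- Separate `a` from `K` by `f` and test the inclusion at a maximiser `d` of `f` on `D`: `f a + f
  -- d = f k + f d' < f a + f d`.
  obtain ⟨f, u, hK, hu⟩ := geometric_hahn_banach_closed_point hKv hKc ha
  obtain ⟨d, hd, hmax⟩ := hD.exists_isMaxOn hDn f.continuous.continuousOn
  obtain ⟨k, hk, d', hd', hEq⟩ := h d hd
  have h1 := congrArg f hEq
  rw [map_add, map_add] at h1
  have h2 : f d' ≤ f d := hmax hd'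
  linarith [hK k hk]

theorem exists_ball_of_mem_intrinsicInterior {s : Set E} {p : E}
    (hp : p ∈ intrinsicInterior ℝ s) :
    ∃ r : ℝ, 0 < r ∧ ∀ w ∈ (affineSpan ℝ s).direction, ‖w‖ ≤ r → p + w ∈ s := by
  obtain ⟨y, hy, rfl⟩ := mem_intrinsicInterior.1 hp
  obtain ⟨r, hr, hball⟩ := Metric.mem_nhds_iff.1 (mem_interior_iff_mem_nhds.1 hy)
  refine ⟨r / 2, by positivity, fun w hw hwr => ?_⟩
  have hmem : (y : E) + w ∈ affineSpan ℝ s := by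
    rw [add_comm]
    exact AffineSubspace.vadd_mem_of_mem_direction hw y.2
  have : (⟨(y : E) + w, hmem⟩ : affineSpan ℝ s) ∈ ((↑) ⁻¹' s : Set (affineSpan ℝ s)) := by
    refine hball ?_
    rw [Metric.mem_ball, Subtype.dist_eq, dist_eq_norm]
    simp only [add_sub_cancel_left]
    linarith
  exact this

theorem mem_intrinsicInterior_of_ball {s : Set E} {p : E} {r : ℝ} (hr : 0 < r)
    (h : ∀ w ∈ (affineSpan ℝ s).direction, ‖w‖ ≤ r → p + w ∈ s) :
    p ∈ intrinsicInterior ℝ s := by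
  have hps : p ∈ s := by simpa using h 0 (Submodule.zero_mem _) (by simpa using hr.le)
  have hp := subset_affineSpan ℝ s hps
  refine mem_intrinsicInterior.2 ⟨⟨p, hp⟩, mem_interior_iff_mem_nhds.2 ?_, rfl⟩
  refine Metric.mem_nhds_iff.2 ⟨r, hr, fun z hz => ?_⟩
  rw [Metric.mem_ball, Subtype.dist_eq, dist_eq_norm] at hz
  have h1 := h ((z : E) - p) (AffineSubspace.vsub_mem_direction z.2 hp) hz.le
  simpa using h1

end Convex

/-! ### Subdifferentials of convex functions -/

section Subdifferential

variable {E : Type*} [NormedAddCommGroup E] [InnerProductSpace ℝ E]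

theorem convex_subdiff (J : E → ℝ) (x : E) : Convex ℝ (subdiff J x) := by
  intro u hu v hv a b ha hb hab y
  have h1 := mul_le_mul_of_nonneg_left (hu y) ha
  have h2 := mul_le_mul_of_nonneg_left (hv y) hb
  rw [inner_add_left, real_inner_smul_left, real_inner_smul_left]
  have e1 : J x = a * J x + b * J x := by rw [← add_mul, hab, one_mul]
  have e2 : J y = a * J y + b * J y := by rw [← add_mul, hab, one_mul]
  rw [e1, e2]
  linarith

theorem isClosed_subdiff (J : E → ℝ) (x : E) : IsClosed (subdiff J x) := by
  have : subdiff J x = ⋂ y : E, {u : E | J x + inner ℝ u (y - x) ≤ J y} := by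
    ext u; simp [subdiff]
  rw [this]
  exact isClosed_iInter fun y => isClosed_le (by fun_prop) continuous_const

theorem isCompact_subdiff [FiniteDimensional ℝ E] {J : E → ℝ} (hJ : ConvexOn ℝ univ J) (x : E) :
    IsCompact (subdiff J x) := by
  obtain ⟨K, V, hV, hK⟩ := hJ.locallyLipschitz x
  obtain ⟨r, hr, hball⟩ := Metric.mem_nhds_iff.1 hV
  refine Metric.isCompact_of_isClosed_isBounded (isClosed_subdiff J x)
    ((Metric.isBounded_closedBall (x := (0 : E)) (r := K)).subset fun u hu => ?_)
  rw [mem_closedBall_zero_iff]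
  by_cases hu0 : u = 0
  · simp [hu0]
  have hun : 0 < ‖u‖ := norm_pos_iff.2 hu0
  -- A local Lipschitz constant bounds every subgradient `u`: test the subgradient inequality at a
  -- step along `u` short enough to stay in the ball.
  set t : ℝ := r / (2 * ‖u‖) with ht
  have ht0 : 0 < t := by positivity
  have hnt : ‖t • u‖ = r / 2 := by
    rw [norm_smul, Real.norm_of_nonneg ht0.le, ht]; field_simp
  have hmem : x + t • u ∈ V := hball (by
    rw [Metric.mem_ball, dist_eq_norm, add_sub_cancel_left, hnt]; linarith)
  have h1 := hK.dist_le_mul _ hmem _ (mem_of_mem_nhds hV)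
  rw [dist_eq_norm, dist_eq_norm, add_sub_cancel_left, norm_smul, Real.norm_of_nonneg ht0.le] at h1
  have h2 := hu (x + t • u)
  rw [add_sub_cancel_left, real_inner_smul_right, real_inner_self_eq_norm_sq] at h2
  have h3 := (le_abs_self _).trans h1
  have h4 : (t * ‖u‖) * ‖u‖ ≤ (t * ‖u‖) * K := by nlinarith
  exact le_of_mul_le_mul_left h4 (by positivity)

/-- At points of a subspace `T` where a convex function agrees along `T` with a differentiable one,
the subgradients have prescribed inner products with the elements of `T`. -/
theorem inner_eq_fderiv_of_mem_subdiff {J g : E → ℝ} {T : Submodule ℝ E} {y : E} (hy : y ∈ T)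
    (hg : DifferentiableAt ℝ g y) (hJg : ∀ᶠ z in 𝓝[(T : Set E)] y, J z = g z) {u : E}
    (hu : u ∈ subdiff J y) {h : E} (hh : h ∈ T) : inner ℝ u h = fderiv ℝ g y h := by
  have hline : HasDerivAt (fun t : ℝ => y + t • h) h 0 := by
    simpa using ((hasDerivAt_id (0 : ℝ)).smul_const h).const_add y
  have hder : HasDerivAt (fun t : ℝ => g (y + t • h)) (fderiv ℝ g y h) 0 := by
    have hg' : HasFDerivAt g (fderiv ℝ g y) (y + (0 : ℝ) • h) := by simpa using hg.hasFDerivAt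
    exact hg'.comp_hasDerivAt (0 : ℝ) hline
  -- The subgradient inequality makes `t = 0` a local minimum once the linear term is subtracted.
  have hder2 : HasDerivAt (fun t : ℝ => g (y + t • h) - t * inner ℝ u h)
      (fderiv ℝ g y h - inner ℝ u h) 0 := by
    have := hder.sub ((hasDerivAt_id (0 : ℝ)).mul_const (inner ℝ u h))
    rw [one_mul] at this
    exact this
  have htend : Tendsto (fun t : ℝ => y + t • h) (𝓝 0) (𝓝[(T : Set E)] y) := by
    refine tendsto_nhdsWithin_iff.2 ⟨?_, Eventually.of_forall fun t =>
      T.add_mem hy (T.smul_mem t hh)⟩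
    simpa using hline.continuousAt.tendsto
  have hmin : IsLocalMin (fun t : ℝ => g (y + t • h) - t * inner ℝ u h) 0 := by
    filter_upwards [htend.eventually hJg] with t ht
    have h0 : J y = g y := hJg.self_of_nhdsWithin hy
    have h1 := hu (y + t • h)
    rw [add_sub_cancel_left, real_inner_smul_right, ht, h0] at h1
    simp only [zero_smul, add_zero, zero_mul, sub_zero]
    linarith
  have := hmin.hasDerivAt_eq_zero hder2
  linarith

theorem toDual_symm_fderiv_mem_subdiff [CompleteSpace E] {J : E → ℝ} (hJ : ConvexOn ℝ univ J)
    {x : E} (hx : DifferentiableAt ℝ J x) :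
    (InnerProductSpace.toDual ℝ E).symm (fderiv ℝ J x) ∈ subdiff J x := by
  intro y
  rw [InnerProductSpace.toDual_symm_apply]
  have hline : HasDerivAt (fun t : ℝ => x + t • (y - x)) (y - x) 0 := by
    simpa using ((hasDerivAt_id (0 : ℝ)).smul_const (y - x)).const_add x
  have hder : HasDerivAt (fun t : ℝ => J (x + t • (y - x))) (fderiv ℝ J x (y - x)) 0 := by
    have hg' : HasFDerivAt J (fderiv ℝ J x) (x + (0 : ℝ) • (y - x)) := by simpa using hx.hasFDerivAt
    exact hg'.comp_hasDerivAt (0 : ℝ) hline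
  have hconv : ConvexOn ℝ univ (fun t : ℝ => J (x + t • (y - x))) := by
    refine ⟨convex_univ, fun s _ t _ a b ha hb hab => ?_⟩
    have := hJ.2 (mem_univ (x + s • (y - x))) (mem_univ (x + t • (y - x))) ha hb hab
    have e : x + (a • s + b • t) • (y - x) =
        a • (x + s • (y - x)) + b • (x + t • (y - x)) := by
      have : x = (a + b) • x := by rw [hab, one_smul]
      nth_rewrite 1 [this]
      module
    simpa only [e] using this
  have h1 := hconv.le_slope_of_hasDerivAt (mem_univ 0) (mem_univ 1) one_pos hder
  rw [slope_def_field] at h1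
  simp only [one_smul, zero_smul, add_zero, add_sub_cancel, sub_zero, div_one] at h1
  linarith

theorem sub_mem_paraSubspace {J : E → ℝ} {x u v : E} (hu : u ∈ subdiffAff J x)
    (hv : v ∈ subdiffAff J x) : u - v ∈ paraSubspace J x :=
  AffineSubspace.vsub_mem_direction hu hv

theorem modelVector_mem [FiniteDimensional ℝ E] {J : E → ℝ} {x : E}
    (h : (subdiff J x).Nonempty) : modelVector J x ∈ subdiffAff J x := by
  have h' : (subdiffAff J x : Set E).Nonempty := h.mono (subset_affineSpan ℝ _)
  rw [modelVector, dif_pos h']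
  have : Nonempty (subdiffAff J x) := h'.to_subtype
  exact EuclideanGeometry.orthogonalProjection_mem 0

theorem modelVector_mem_modelSubspace [FiniteDimensional ℝ E] (J : E → ℝ) (x : E) :
    modelVector J x ∈ modelSubspace J x := by
  unfold modelVector
  split_ifs with h'
  · have : Nonempty (subdiffAff J x) := h'.to_subtype
    have := EuclideanGeometry.orthogonalProjection_vsub_mem_direction_orthogonal
      (subdiffAff J x) 0
    simpa [modelSubspace, paraSubspace] using this
  · exact Submodule.zero_mem _

theorem orthogonal_modelSubspace [FiniteDimensional ℝ E] (J : E → ℝ) (x : E) :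
    (modelSubspace J x)ᗮ = paraSubspace J x :=
  Submodule.orthogonal_orthogonal _

end Subdifferential

/-! ### Local constancy of the model subspace and persistence of the subdifferential -/

section PartlySmooth

variable {E : Type*} [NormedAddCommGroup E] [InnerProductSpace ℝ E] [FiniteDimensional ℝ E]

/-- An empty subdifferential would make `T_x` the whole space; `J` would then be differentiable at
`x`, and its gradient would be a subgradient. -/
theorem subdiff_nonempty_of_isC2RestrictAround {J : E → ℝ} (hJ : ConvexOn ℝ univ J) {x : E}
    (h : IsC2RestrictAround J (modelSubspace J x : Set E) x) : (subdiff J x).Nonempty := by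
  by_contra hne
  rw [not_nonempty_iff_eq_empty] at hne
  have htop : modelSubspace J x = ⊤ := by
    simp [modelSubspace, paraSubspace, subdiffAff, hne]
  obtain ⟨g, hg, hJg⟩ := h
  rw [htop, Submodule.top_coe, nhdsWithin_univ] at hJg
  have hd : DifferentiableAt ℝ J x := (hg.differentiableAt (by norm_num)).congr_of_eventuallyEq hJg
  have := toDual_symm_fderiv_mem_subdiff hJ hd
  rw [hne] at this
  exact this

/-- Two subgradients at `y` have equal inner products with `T_x`, so their difference lies in its
orthogonal complement `S_x`. -/
theorem eventually_paraSubspace_le {J : E → ℝ} {x : E}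
    (h : IsC2RestrictAround J (modelSubspace J x : Set E) x) :
    ∀ᶠ y in 𝓝[(modelSubspace J x : Set E)] x, paraSubspace J y ≤ paraSubspace J x := by
  obtain ⟨g, hg, hJg⟩ := h
  have h1 : ∀ᶠ y in 𝓝[(modelSubspace J x : Set E)] x, DifferentiableAt ℝ g y := by
    refine nhdsWithin_le_nhds ?_
    filter_upwards [hg.eventually (by simp)] with y hy
    exact hy.differentiableAt (by norm_num)
  filter_upwards [h1, eventually_eventually_nhdsWithin.2 hJg, self_mem_nhdsWithin] with y hy1 hy2 hy3
  rw [paraSubspace, subdiffAff, direction_affineSpan, vectorSpan_def, Submodule.span_le]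
  rintro _ ⟨u, hu, v, hv, rfl⟩
  rw [SetLike.mem_coe, ← orthogonal_modelSubspace, Submodule.mem_orthogonal']
  intro w hw
  simp only [vsub_eq_sub]
  rw [inner_sub_left, inner_eq_fderiv_of_mem_subdiff hy3 hy1 hy2 hu hw,
    inner_eq_fderiv_of_mem_subdiff hy3 hy1 hy2 hv hw, sub_self]

/-- If `∂J(x)` contains a relative ball of radius `r` and lies within `ε < r` of `∂J(y)`, then
`S_y ⊆ S_x` forces `S_y = S_x`. -/
theorem paraSubspace_le_of_close {J : E → ℝ} {x y v : E} {r ε : ℝ} (hr : 0 < r) (hε : ε < r)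
    (hball : ∀ w ∈ paraSubspace J x, ‖w‖ ≤ r → v + w ∈ subdiff J x)
    (hle : paraSubspace J y ≤ paraSubspace J x)
    (hclose : ∀ u ∈ subdiff J x, ∃ w ∈ subdiff J y, ‖u - w‖ ≤ ε) :
    paraSubspace J x ≤ paraSubspace J y := by
  intro s hs
  set p := (paraSubspace J y).starProjection s with hp
  have hpmem : p ∈ paraSubspace J y := Submodule.starProjection_apply_mem _ _
  have hd : s - p ∈ (paraSubspace J y)ᗮ := Submodule.sub_starProjection_mem_orthogonal s
  have hdS : s - p ∈ paraSubspace J x := Submodule.sub_mem _ hs (hle hpmem)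
  suffices h0 : s - p = 0 by rw [sub_eq_zero.1 h0]; exact hpmem
  by_contra hne
  have hn : 0 < ‖s - p‖ := norm_pos_iff.2 hne
  -- Here `w ∈ S_x` has length `r` and is orthogonal to `S_y`. If `a, b ∈ ∂J(y)` are `ε`-close to `v
  -- ± w`, then `a - b ⊥ w` gives `2 r² ≤ 2 ε r`, contradicting `ε < r`.
  set w := (r / ‖s - p‖) • (s - p) with hw
  have hwS : w ∈ paraSubspace J x := Submodule.smul_mem _ _ hdS
  have hwo : w ∈ (paraSubspace J y)ᗮ := Submodule.smul_mem _ _ hd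
  have hwn : ‖w‖ = r := by
    rw [hw, norm_smul, Real.norm_of_nonneg (by positivity)]; field_simp
  obtain ⟨a, ha, hab⟩ := hclose _ (hball w hwS hwn.le)
  obtain ⟨b, hb, hbb⟩ := hclose _ (hball (-w) (Submodule.neg_mem _ hwS) (by rw [norm_neg, hwn]))
  have h1 : inner ℝ (a - b) w = 0 :=
    (Submodule.mem_orthogonal _ _).1 hwo _ (sub_mem_paraSubspace
      (subset_affineSpan ℝ _ ha) (subset_affineSpan ℝ _ hb))
  have h2 : (2 : ℝ) • w = (v + w - a) - (v + -w - b) + (a - b) := by module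
  have h3 := congrArg (fun z => inner ℝ z w) h2
  simp only [inner_add_left, h1, real_inner_smul_left, real_inner_self_eq_norm_sq, hwn] at h3
  have h4 := real_inner_le_norm ((v + w - a) - (v + -w - b)) w
  have h5 := norm_sub_le (v + w - a) (v + -w - b)
  rw [hwn] at h4
  nlinarith

/-- Near `x` on `T_x` the model subspace is constant and the subdifferential is Lipschitz. -/
theorem exists_locally_constant_paraSubspace {J : E → ℝ} (hJ : ConvexOn ℝ univ J) {x : E}
    (hps : PartlySmoothAt J x (modelSubspace J x : Set E))
    (hLip : SetLipschitzAround (subdiff J) (modelSubspace J x : Set E) x) :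
    ∃ β ρ : ℝ, 0 ≤ β ∧ 0 < ρ ∧ ∀ y ∈ modelSubspace J x, ‖y - x‖ < ρ →
      (subdiff J y).Nonempty ∧ paraSubspace J y = paraSubspace J x ∧
      ∀ z ∈ modelSubspace J x, ‖z - x‖ < ρ →
        ∀ u ∈ subdiff J y, ∃ w ∈ subdiff J z, ‖u - w‖ ≤ β * ‖y - z‖ := by
  have hxT : x ∈ modelSubspace J x := hps.manifold.1
  have hne := subdiff_nonempty_of_isC2RestrictAround hJ hps.smooth
  obtain ⟨v, hv⟩ := hne.intrinsicInterior (convex_subdiff J x)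
  obtain ⟨r, hr, hball⟩ := exists_ball_of_mem_intrinsicInterior hv
  obtain ⟨β, hβ, U, hU, hUL⟩ := hLip
  obtain ⟨ρ₁, hρ₁, h₁⟩ := Metric.mem_nhds_iff.1 hU
  obtain ⟨ρ₂, hρ₂, h₂⟩ := Metric.mem_nhdsWithin_iff.1 (eventually_paraSubspace_le hps.smooth)
  have hL : ∀ y ∈ modelSubspace J x, ‖y - x‖ < ρ₁ → ∀ z ∈ modelSubspace J x, ‖z - x‖ < ρ₁ →
      ∀ u ∈ subdiff J y, ∃ w ∈ subdiff J z, ‖u - w‖ ≤ β * ‖y - z‖ := by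
    intro y hy hyρ z hz hzρ u hu
    obtain ⟨w, hw, b, hb, rfl⟩ := hUL y ⟨h₁ (by rwa [Metric.mem_ball, dist_eq_norm]), hy⟩ z
      ⟨h₁ (by rwa [Metric.mem_ball, dist_eq_norm]), hz⟩ hu
    refine ⟨w, hw, ?_⟩
    simpa using hb
  -- The radius `r / (β + 1)` forces `β * ‖x - y‖ < r`, also when `β = 0`.
  refine ⟨β, min ρ₁ (min ρ₂ (r / (β + 1))), hβ, by positivity, fun y hy hyρ => ?_⟩
  obtain ⟨hy1, hy2, hy3⟩ : ‖y - x‖ < ρ₁ ∧ ‖y - x‖ < ρ₂ ∧ ‖y - x‖ < r / (β + 1) := by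
    simpa [lt_min_iff] using hyρ
  have hclose := hL x hxT (by simpa using hρ₁) y hy hy1
  have hle : paraSubspace J y ≤ paraSubspace J x :=
    h₂ ⟨by rwa [Metric.mem_ball, dist_eq_norm], hy⟩
  refine ⟨?_, le_antisymm hle (paraSubspace_le_of_close hr (ε := β * ‖x - y‖) ?_ hball hle hclose),
    fun z hz hzρ => hL y hy hy1 z hz (hzρ.trans_le (min_le_left _ _))⟩
  · obtain ⟨u, hu⟩ := hne
    obtain ⟨w, hw, -⟩ := hclose u hu
    exact ⟨w, hw⟩
  · rw [norm_sub_rev]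
    have := (lt_div_iff₀ (by positivity)).1 hy3
    nlinarith [norm_nonneg (y - x)]

theorem modelVector_sub_mem {J : E → ℝ} {x y z : E}
    (hy : paraSubspace J y = paraSubspace J x) (hz : paraSubspace J z = paraSubspace J x) :
    modelVector J y - modelVector J z ∈ modelSubspace J x := by
  have h1 := modelVector_mem_modelSubspace J y
  have h2 := modelVector_mem_modelSubspace J z
  simp only [modelSubspace, hy, hz] at h1 h2 ⊢
  exact Submodule.sub_mem _ h1 h2

/-- The distance of model vectors is at most the distance of subgradients, if the model subspaces
agree. -/
theorem norm_modelVector_sub_le {J : E → ℝ} {x y z u w : E}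
    (hy : paraSubspace J y = paraSubspace J x) (hz : paraSubspace J z = paraSubspace J x)
    (hu : u ∈ subdiff J y) (hw : w ∈ subdiff J z) :
    ‖modelVector J y - modelVector J z‖ ≤ ‖u - w‖ := by
  have hT := modelVector_sub_mem hy hz
  have h1 : u - modelVector J y ∈ paraSubspace J x :=
    hy ▸ sub_mem_paraSubspace (subset_affineSpan ℝ _ hu) (modelVector_mem ⟨u, hu⟩)
  have h2 : w - modelVector J z ∈ paraSubspace J x :=
    hz ▸ sub_mem_paraSubspace (subset_affineSpan ℝ _ hw) (modelVector_mem ⟨w, hw⟩)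
  set e := modelVector J y - modelVector J z with he
  have h3 : inner ℝ ((u - modelVector J y) - (w - modelVector J z)) e = 0 :=
    (Submodule.mem_orthogonal _ _).1 hT _ (Submodule.sub_mem _ h1 h2)
  have h4 : u - w = ((u - modelVector J y) - (w - modelVector J z)) + e := by rw [he]; abel
  have h5 : inner ℝ (u - w) e = ‖e‖ * ‖e‖ := by
    rw [h4, inner_add_left, h3, zero_add, real_inner_self_eq_norm_mul_norm]
  have h6 := real_inner_le_norm (u - w) e
  rw [h5] at h6
  rcases (norm_nonneg e).eq_or_lt with h0 | h0
  · rw [← h0]; exact norm_nonneg _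
  · exact le_of_mul_le_mul_right h6 h0

/-- A relative ball in `∂J(x)` survives, translated and shrunk, in nearby subdifferentials. -/
theorem add_mem_subdiff_of_close {J : E → ℝ} {x y v : E} {r ε : ℝ} (hε : 0 ≤ ε)
    (hy : paraSubspace J y = paraSubspace J x)
    (hball : ∀ w ∈ paraSubspace J x, ‖w‖ ≤ r → v + w ∈ subdiff J x)
    (hclose : ∀ u ∈ subdiff J x, ∃ w ∈ subdiff J y, ‖u - w‖ ≤ ε) {w : E}
    (hw : w ∈ paraSubspace J x) (hwr : ‖w‖ ≤ r - ε) :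
    v + (modelVector J y - modelVector J x) + w ∈ subdiff J y := by
  refine mem_of_forall_add_mem_add (D := Metric.closedBall 0 ε ∩ (paraSubspace J x : Set E))
    (isClosed_subdiff J y) (convex_subdiff J y)
    ((isCompact_closedBall _ _).inter_right (Submodule.closed_of_finiteDimensional _))
    ⟨0, by simpa using hε, Submodule.zero_mem _⟩ ?_
  rintro d ⟨hdε, hdS⟩
  rw [mem_closedBall_zero_iff] at hdε
  have hu := hball (w + d) (Submodule.add_mem _ hw hdS) ((norm_add_le _ _).trans (by linarith))
  obtain ⟨k, hk, hkε⟩ := hclose _ hu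
  have h1 : v + (w + d) - modelVector J x ∈ paraSubspace J x :=
    sub_mem_paraSubspace (subset_affineSpan ℝ _ hu) (modelVector_mem ⟨_, hu⟩)
  have h2 : k - modelVector J y ∈ paraSubspace J x :=
    hy ▸ sub_mem_paraSubspace (subset_affineSpan ℝ _ hk) (modelVector_mem ⟨_, hk⟩)
  -- `b` is the `S`-component of `v + (w + d) - k`, hence no longer than `ε`; the translation by
  -- `e_y - e_x` absorbs the `T`-component.
  set b := (v + (w + d) - modelVector J x) - (k - modelVector J y) with hb
  have hbS : b ∈ paraSubspace J x := Submodule.sub_mem _ h1 h2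
  refine ⟨k, hk, b, ⟨?_, hbS⟩, by rw [hb]; abel⟩
  rw [mem_closedBall_zero_iff]
  refine le_trans ?_ hkε
  have hT : modelVector J y - modelVector J x ∈ modelSubspace J x := modelVector_sub_mem hy rfl
  have h3 : inner ℝ b (modelVector J y - modelVector J x) = 0 :=
    (Submodule.mem_orthogonal _ _).1 hT _ hbS
  have h4 : v + (w + d) - k = b - (modelVector J y - modelVector J x) := by rw [hb]; abel
  have h5 := norm_sub_sq_real b (modelVector J y - modelVector J x)
  rw [← h4, h3] at h5
  refine (sq_le_sq₀ (norm_nonneg _) (norm_nonneg _)).1 ?_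
  nlinarith [sq_nonneg ‖modelVector J y - modelVector J x‖]

/-- Translating one relative interior point `v` of `∂J(x)` by `e_y - e_x` works: the Lipschitz
constant is `β`, and a relative ball of radius `r - β * ‖x - y‖` around the translate stays in
`∂J(y)`. -/
theorem exists_isLipschitzSelectionAround {J : E → ℝ} (hJ : ConvexOn ℝ univ J) {x : E}
    (hps : PartlySmoothAt J x (modelSubspace J x : Set E))
    (hLip : SetLipschitzAround (subdiff J) (modelSubspace J x : Set E) x) :
    ∃ f : E → E, IsLipschitzSelectionAround J x f := by
  have hxT : x ∈ modelSubspace J x := hps.manifold.1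
  obtain ⟨β, ρ, hβ, hρ, hloc⟩ := exists_locally_constant_paraSubspace hJ hps hLip
  obtain ⟨hne, -, hx⟩ := hloc x hxT (by simpa using hρ)
  obtain ⟨v, hv⟩ := hne.intrinsicInterior (convex_subdiff J x)
  obtain ⟨r, hr, hball⟩ := exists_ball_of_mem_intrinsicInterior hv
  refine ⟨fun y => v + (modelVector J y - modelVector J x),
    Metric.ball x (min ρ (r / (β + 1))), Metric.ball_mem_nhds _ (by positivity), ⟨⟨β, hβ⟩, ?_⟩, ?_⟩
  · refine LipschitzOnWith.of_dist_le_mul fun y hy z hz => ?_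
    have hyρ : ‖y - x‖ < ρ := by
      have := hy.1
      rw [Metric.mem_ball, dist_eq_norm] at this
      exact this.trans_le (min_le_left _ _)
    have hzρ : ‖z - x‖ < ρ := by
      have := hz.1
      rw [Metric.mem_ball, dist_eq_norm] at this
      exact this.trans_le (min_le_left _ _)
    obtain ⟨⟨u, hu⟩, hyS, hyL⟩ := hloc y hy.2 hyρ
    obtain ⟨-, hzS, -⟩ := hloc z hz.2 hzρ
    obtain ⟨w, hw, huw⟩ := hyL z hz.2 hzρ u hu
    rw [dist_add_left, dist_sub_right, dist_eq_norm, dist_eq_norm]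
    exact (norm_modelVector_sub_le hyS hzS hu hw).trans huw
  · rintro y ⟨hy, hyT⟩
    rw [Metric.mem_ball, dist_eq_norm, lt_min_iff] at hy
    obtain ⟨-, hyS, -⟩ := hloc y hyT hy.1
    have hlt : β * ‖x - y‖ < r := by
      rw [norm_sub_rev]
      have := (lt_div_iff₀ (by positivity)).1 hy.2
      nlinarith [norm_nonneg (y - x)]
    refine mem_intrinsicInterior_of_ball (r := r - β * ‖x - y‖) (by linarith) fun w hw hwr => ?_
    have hw' : w ∈ paraSubspace J x := hyS ▸ hw
    exact add_mem_subdiff_of_close (by positivity) hyS hball (hx y hyT hy.1) hw' hwr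

/-- If `∂J(x) - p` contains a relative ball of radius `r` and lies within `δ * r` of `∂J(y) - q`,
then `(1 - δ) • (∂J(x) - p)` is contained in `∂J(y) - q`. -/
theorem smul_mem_image_sub_of_close {J : E → ℝ} (hJ : ConvexOn ℝ univ J) {x y p q : E} {r δ : ℝ}
    (hδ0 : 0 ≤ δ) (hδ1 : δ ≤ 1) (hy : paraSubspace J y = paraSubspace J x)
    (hp : p ∈ subdiff J x) (hq : q ∈ subdiff J y)
    (hball : ∀ w ∈ paraSubspace J x, ‖w‖ ≤ r → p + w ∈ subdiff J x)
    (hclose : ∀ u ∈ subdiff J x, ∃ w ∈ subdiff J y, ‖(u - p) - (w - q)‖ ≤ δ * r)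
    {c : E} (hc : c ∈ (fun η => η - p) '' subdiff J x) :
    (1 - δ) • c ∈ (fun η => η - q) '' subdiff J y := by
  have hCc : IsCompact ((fun η => η - p) '' subdiff J x) :=
    (isCompact_subdiff hJ x).image (by fun_prop)
  have hKc : IsClosed ((fun η => η - q) '' subdiff J y) :=
    ((isCompact_subdiff hJ y).image (by fun_prop)).isClosed
  have hCv : Convex ℝ ((fun η => η - p) '' subdiff J x) := by
    simpa [sub_eq_add_neg, add_comm] using (convex_subdiff J x).translate (-p)
  have hKv : Convex ℝ ((fun η => η - q) '' subdiff J y) := by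
    simpa [sub_eq_add_neg, add_comm] using (convex_subdiff J y).translate (-q)
  -- By convexity `(1 - δ) • c + δ • c'` is some `u - p` with `u ∈ ∂J(x)`. Its error to `w - q` lies
  -- in `S` and has norm at most `δ * r`, so the relative ball places the error in `D`.
  refine mem_of_forall_add_mem_add (D := δ • ((fun η => η - p) '' subdiff J x)) hKc hKv
    (hCc.smul δ) (Set.Nonempty.smul_set ⟨c, hc⟩) ?_
  rintro _ ⟨c', hc', rfl⟩
  obtain ⟨u, hu, huc⟩ := hCv hc hc' (sub_nonneg.2 hδ1) hδ0 (sub_add_cancel 1 δ)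
  obtain ⟨w, hw, hwn⟩ := hclose u hu
  refine ⟨w - q, ⟨w, hw, rfl⟩, (u - p) - (w - q), ?_, ?_⟩
  · have hS : (u - p) - (w - q) ∈ paraSubspace J x := by
      refine Submodule.sub_mem _ (sub_mem_paraSubspace (subset_affineSpan ℝ _ hu)
        (subset_affineSpan ℝ _ hp)) ?_
      rw [← hy]
      exact sub_mem_paraSubspace (subset_affineSpan ℝ _ hw) (subset_affineSpan ℝ _ hq)
    rcases hδ0.eq_or_lt with h0 | h0
    · rw [← h0, zero_mul] at hwn
      rw [norm_le_zero_iff.1 hwn]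
      exact ⟨c, hc, by simp [← h0]⟩
    · refine (mem_smul_set_iff_inv_smul_mem₀ h0.ne' _ _).2
        ⟨p + δ⁻¹ • ((u - p) - (w - q)), hball _ (Submodule.smul_mem _ _ hS) ?_, by simp⟩
      rw [norm_smul, norm_inv, Real.norm_of_nonneg hδ0, inv_mul_le_iff₀ h0]
      exact hwn
  · simp only at huc ⊢
    rw [huc]; abel

end PartlySmooth

/-! ### Quantitative bounds for selections and subdifferential gauges -/

section Estimates

theorem EReal.coe_le_coe_mul_coe {a c G : ℝ} (h : a ≤ c * G) :
    (a : EReal) ≤ (c : EReal) * (G : EReal) := by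
  rw [← EReal.coe_mul]
  exact_mod_cast h

variable {E : Type*} [NormedAddCommGroup E] [InnerProductSpace ℝ E]

/-- A Lipschitz selection around `x` is Lipschitz relative to `x`, with values in the nearby
subdifferentials, and `∂J(x)` contains a relative ball around its value at `x`. -/
theorem IsLipschitzSelectionAround.exists_ball {J : E → ℝ} {x : E} {f : E → E}
    (hf : IsLipschitzSelectionAround J x f) (hx : x ∈ modelSubspace J x) :
    ∃ L ρ r : ℝ, 0 ≤ L ∧ 0 < ρ ∧ 0 < r ∧
      (∀ w ∈ paraSubspace J x, ‖w‖ ≤ r → f x + w ∈ subdiff J x) ∧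
      ∀ y ∈ modelSubspace J x, ‖y - x‖ < ρ →
        f y ∈ subdiff J y ∧ ‖f x - f y‖ ≤ L * ‖y - x‖ := by
  obtain ⟨U, hU, ⟨L, hL⟩, hri⟩ := hf
  obtain ⟨ρ, hρ, hball⟩ := Metric.mem_nhds_iff.1 hU
  have hxU := mem_of_mem_nhds hU
  obtain ⟨r, hr, hrb⟩ := exists_ball_of_mem_intrinsicInterior (hri x ⟨hxU, hx⟩)
  refine ⟨L, ρ, r, L.2, hρ, hr, hrb, fun y hy hyρ => ?_⟩
  have hyU : y ∈ U := hball (by rwa [Metric.mem_ball, dist_eq_norm])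
  refine ⟨intrinsicInterior_subset (hri y ⟨hyU, hy⟩), ?_⟩
  have := hL.dist_le_mul x ⟨hxU, hx⟩ y ⟨hyU, hy⟩
  rwa [dist_eq_norm, dist_eq_norm, norm_sub_rev x y] at this

/-- The relative increase of the subdifferential gauge is at most `2 δ` if the set at `y` contains
the set at `x` scaled by `1 - δ`. -/
theorem subdiffGauge_sub_div_le [FiniteDimensional ℝ E] {J : E → ℝ} (hJ : ConvexOn ℝ univ J) {x y p q u : E} {r δ : ℝ}
    (hr : 0 < r) (hδ0 : 0 ≤ δ) (hδ1 : δ ≤ 1 / 2)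
    (hball : ∀ w ∈ paraSubspace J x, ‖w‖ ≤ r → p + w ∈ subdiff J x)
    (hsc : ∀ c ∈ (fun η => η - p) '' subdiff J x, (1 - δ) • c ∈ (fun η => η - q) '' subdiff J y)
    (hu : u ∈ paraSubspace J x) (hu0 : u ≠ 0) :
    (subdiffGauge J y q u - subdiffGauge J x p u) / subdiffGauge J x p u ≤
      ((2 * δ : ℝ) : EReal) := by
  have hball' : ∀ w ∈ paraSubspace J x, ‖w‖ ≤ r → w ∈ (fun η => η - p) '' subdiff J x :=
    fun w hw hwr => ⟨p + w, hball w hw hwr, by simp⟩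
  obtain ⟨g, -, hg⟩ := exists_real_eq_gaugeFun
    ((gaugeFun_le_norm_div hr hball' hu).trans_lt (EReal.coe_lt_top _))
  -- Compactness of `∂J(x)` makes its gauge positive off `0`, so the quotient is an honest real one.
  have hg0 : 0 < g := by
    obtain ⟨R, hR⟩ := ((isCompact_subdiff hJ x).image
      (show Continuous fun η => η - p by fun_prop)).isBounded.exists_norm_le
    have h1 := norm_div_le_gaugeFun (C := (fun η => η - p) '' subdiff J x) (S := ⊤)
      (R := max R 1) (by positivity) (fun c hc _ => (hR c hc).trans (le_max_left _ _))
      (u := u) trivial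
    rw [hg] at h1
    have h2 : ‖u‖ / max R 1 ≤ g := by exact_mod_cast h1
    have h3 : 0 < ‖u‖ := norm_pos_iff.2 hu0
    exact lt_of_lt_of_le (by positivity) h2
  have h1 := gaugeFun_le_div_of_smul_mem (by linarith : 0 < 1 - δ) hsc hg
  obtain ⟨g', -, hg'⟩ := exists_real_eq_gaugeFun (h1.trans_lt (EReal.coe_lt_top _))
  rw [hg'] at h1
  have h2 : g' ≤ g / (1 - δ) := by exact_mod_cast h1
  rw [subdiffGauge, subdiffGauge, hg, hg', ← EReal.coe_sub, ← EReal.coe_div]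
  rw [le_div_iff₀ (by linarith)] at h2
  -- From `g' * (1 - δ) ≤ g` follows `g' - g ≤ δ * g'`, and `δ ≤ 1 / 2` gives `g' ≤ 2 * g`.
  have h3 : (g' - g) / g ≤ 2 * δ := by
    rw [div_le_iff₀ hg0]
    have h4 : g' ≤ 2 * g := by nlinarith [mul_nonneg hδ0 hg0.le]
    nlinarith [mul_le_mul_of_nonneg_left h4 hδ0]
  exact_mod_cast h3

end Estimates

/-! ### Assembly of the constants -/

theorem theorem4p1 (N : ℕ) (J : EuclideanSpace ℝ (Fin N) → ℝ)
    (hJ : ConvexOn ℝ Set.univ J) (x : EuclideanSpace ℝ (Fin N))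
    (hps : PartlySmoothAt J x (modelSubspace J x : Set (EuclideanSpace ℝ (Fin N))))
    (hLip : SetLipschitzAround (subdiff J)
      (modelSubspace J x : Set (EuclideanSpace ℝ (Fin N))) x)
    (Γ : EuclideanSpace ℝ (Fin N) → EReal) (hΓ : IsGauge Γ)
    (hΓT : FiniteCoerciveOn Γ (modelSubspace J x)) :
    (∃ f : EuclideanSpace ℝ (Fin N) → EuclideanSpace ℝ (Fin N),
      IsLipschitzSelectionAround J x f) ∧
    ∀ f : EuclideanSpace ℝ (Fin N) → EuclideanSpace ℝ (Fin N),
      IsLipschitzSelectionAround J x f →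
      ∃ ν μ τ ξ : ℝ, 0 < ν ∧ 0 ≤ μ ∧ 0 ≤ τ ∧ 0 ≤ ξ ∧
        (∀ x' ∈ modelSubspace J x, Γ (x - x') ≤ (ν : EReal) →
          modelSubspace J x' = modelSubspace J x) ∧
        ∀ x' ∈ modelSubspace J x, Γ (x - x') < (ν : EReal) →
          Γ (modelVector J x - modelVector J x') ≤ (μ : EReal) * Γ (x - x') ∧
          subdiffGauge J x (f x) ((paraSubspace J x).starProjection (f x - f x')) ≤
            (τ : EReal) * Γ (x - x') ∧
          (⨆ u ∈ {u : EuclideanSpace ℝ (Fin N) | u ∈ paraSubspace J x ∧ u ≠ 0},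
              (subdiffGauge J x' (f x') u - subdiffGauge J x (f x) u) /
                subdiffGauge J x (f x) u) ≤
            (ξ : EReal) * Γ (x - x') := by
  have hxT : x ∈ modelSubspace J x := hps.manifold.1
  refine ⟨exists_isLipschitzSelectionAround hJ hps hLip, fun f hf => ?_⟩
  obtain ⟨β, ρ₁, hβ, hρ₁, hloc⟩ := exists_locally_constant_paraSubspace hJ hps hLip
  obtain ⟨L, ρ₂, r, hL, hρ₂, hr, hball, hfL⟩ := hf.exists_ball hxT
  obtain ⟨C, hCcl, hCcv, hC0, rfl⟩ := hΓ
  obtain ⟨s, hs, hsball⟩ := exists_ball_subset_of_gaugeFun_lt_top hCcl hCcv hC0 hΓT.1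
  obtain ⟨R, hR, hRb⟩ := exists_norm_le_of_tendsto_gaugeFun hΓT.2
  have hlow : ∀ x' ∈ modelSubspace J x, ∃ G : ℝ, 0 ≤ G ∧ gaugeFun C (x - x') = G ∧
      ‖x' - x‖ ≤ R * G := by
    intro x' hx'
    have hmem := Submodule.sub_mem _ hxT hx'
    obtain ⟨G, hG0, hG⟩ := exists_real_eq_gaugeFun (hΓT.1 _ hmem)
    refine ⟨G, hG0, hG, ?_⟩
    have h1 := norm_div_le_gaugeFun hR hRb hmem
    rw [hG] at h1
    have h2 : ‖x - x'‖ / R ≤ G := by exact_mod_cast h1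
    rwa [norm_sub_rev, mul_comm, ← div_le_iff₀ hR]
  -- The last radius ensures `δ ≤ 1 / 2` for the `δ` of the gauge estimate.
  set ρ : ℝ := min (min ρ₁ ρ₂) (r / (2 * (β + L + 1))) with hρ
  have hρ0 : 0 < ρ := by positivity
  have hnear : ∀ x' ∈ modelSubspace J x, gaugeFun C (x - x') ≤ ((ρ / (2 * R) : ℝ) : EReal) →
      ‖x' - x‖ < ρ := by
    intro x' hx' hle
    obtain ⟨G, -, hG, hGR⟩ := hlow x' hx'
    rw [hG] at hle
    have h1 : G ≤ ρ / (2 * R) := by exact_mod_cast hle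
    have h2 : R * G ≤ ρ / 2 := by
      calc R * G ≤ R * (ρ / (2 * R)) := by gcongr
        _ = ρ / 2 := by field_simp
    linarith
  -- The factor `R` converts `Γ (x - x')` into a norm; `s` and `r` convert norms back into `Γ` and
  -- the subdifferential gauge. The `2` in `ν` leaves room for the non-strict `Γ (x - x') ≤ ν`.
  refine ⟨ρ / (2 * R), β * R / s, L * R / r, 2 * ((β + L) * R / r), by positivity, by positivity,
    by positivity, by positivity, fun x' hx' hle => ?_, fun x' hx' hlt => ?_⟩
  · have h1 := (hloc x' hx' ((hnear x' hx' hle).trans_le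
      ((min_le_left _ _).trans (min_le_left _ _)))).2.1
    rw [modelSubspace, modelSubspace, h1]
  obtain ⟨G, hG0, hG, hGR⟩ := hlow x' hx'
  have hdist := hnear x' hx' hlt.le
  rw [hρ, lt_min_iff, lt_min_iff] at hdist
  obtain ⟨⟨hd₁, hd₂⟩, hd₃⟩ := hdist
  obtain ⟨hfx', hfL'⟩ := hfL x' hx' hd₂
  obtain ⟨hfx, -⟩ := hfL x hxT (by simpa using hρ₂)
  obtain ⟨-, hS, -⟩ := hloc x' hx' hd₁
  obtain ⟨-, -, hx⟩ := hloc x hxT (by simpa using hρ₁)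
  have hclose := hx x' hx' hd₁
  rw [norm_sub_rev] at hclose
  rw [hG]
  refine ⟨?_, ?_, ?_⟩
  · refine (gaugeFun_le_norm_div hs hsball (modelVector_sub_mem rfl hS)).trans
      (EReal.coe_le_coe_mul_coe ?_)
    obtain ⟨w, hw, hwn⟩ := hclose _ hfx
    have h1 := norm_modelVector_sub_le rfl hS hfx hw
    rw [div_le_iff₀ hs]
    calc _ ≤ β * ‖x' - x‖ := h1.trans hwn
      _ ≤ β * (R * G) := by gcongr
      _ = β * R / s * G * s := by field_simp
  · refine (gaugeFun_le_norm_div (C := (fun η => η - f x) '' subdiff J x) hr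
      (S := paraSubspace J x)
      (fun w hw hwr => ⟨f x + w, hball w hw hwr, by simp⟩)
      (Submodule.starProjection_apply_mem _ _)).trans (EReal.coe_le_coe_mul_coe ?_)
    rw [div_le_iff₀ hr]
    calc _ ≤ ‖f x - f x'‖ := Submodule.norm_starProjection_apply_le _ _
      _ ≤ L * ‖x' - x‖ := hfL'
      _ ≤ L * (R * G) := by gcongr
      _ = L * R / r * G * r := by field_simp
  · refine iSup₂_le fun u hu => ?_
    -- `δ * r = (β + L) * ‖x' - x‖` bounds the distance between centred subdifferentials: `β` for
    -- the sets, `L` for the centres `f x` and `f x'`.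
    have hδ0 : 0 ≤ (β + L) * ‖x' - x‖ / r := by positivity
    have hδ1 : (β + L) * ‖x' - x‖ / r ≤ 1 / 2 := by
      rw [div_le_iff₀ hr]
      have := (lt_div_iff₀ (by positivity)).1 hd₃
      nlinarith [norm_nonneg (x' - x)]
    refine (subdiffGauge_sub_div_le hJ hr hδ0 hδ1 hball (fun c hc =>
      smul_mem_image_sub_of_close hJ hδ0 (by linarith) hS hfx hfx' hball (fun v hv => ?_) hc)
      hu.1 hu.2).trans (EReal.coe_le_coe_mul_coe ?_)
    · obtain ⟨w, hw, hwn⟩ := hclose v hv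
      refine ⟨w, hw, ?_⟩
      rw [div_mul_cancel₀ _ hr.ne']
      calc ‖v - f x - (w - f x')‖ = ‖(v - w) - (f x - f x')‖ := by congr 1; abel
        _ ≤ ‖v - w‖ + ‖f x - f x'‖ := norm_sub_le _ _
        _ ≤ (β + L) * ‖x' - x‖ := by linarith
    · calc 2 * ((β + L) * ‖x' - x‖ / r) ≤ 2 * ((β + L) * (R * G) / r) := by gcongr
        _ = 2 * ((β + L) * R / r) * G := by ring
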